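/- Let $M$ be a smooth Banach manifold (without boundary), $\pi:E\to M$ a smooth vector bundle whose typical fibre is a Banach space, and $\pi^*E=\{(a,b)\in E\times E:\pi(a)=\pi(b)\}$ the pullback bundle over $E$, $(a,b)\mapsto a$. Identify $T(\pi^*E)$ with $\{(w,w')\in TE\times TE: T\pi(w)=T\pi(w')\}$. Let $\xi^V_\pi(a,b)=\frac{d}{ds}(a+sb)|_{s=0}$ be the vertical lift of $\pi$, which is a bijection $\pi^*E\to\ker T\pi$, and $\nu_\pi:\ker T\pi\to E$, $\nu_\pi(\xi^V_\pi(a,b))=b$. Likewise, for the vector bundle $T\pi:TE\to TM$, whose operations $+_\tau,\cdot_\tau$ are the tangent maps of those of $E$, let $\xi^V_{T\pi}(v,w)=\frac{d}{ds}(v+_\tau s\cdot_\tau w)|_{s=0}$ and $\nu_{T\pi}:\ker TT\pi\to TE$, $\nu_{T\pi}(\xi^V_{T\pi}(v,w))=w$. Let $\mathrm{Hor}$ be a (generally nonlinear) smooth Ehresmann connection on $E$, with horizontal lifting $\xi^H(a,v)\in T_aE$ for $a\in E$, $v\in T_{\pi(a)}M$ (linear in $v$, with $T\pi(\xi^H(a,v))=v$),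 and connector $\kappa(w)=\nu_\pi\bigl(w-\xi^H(a,T\pi(w))\bigr)$ for $w\in T_aE$. Its linearized connection is the connection on $\pi^*E\to E$ with horizontal lifting $$((a,b),w)\mapsto (w,B(a,b)w),\qquad B(a,b)w=\nu_{T\pi}\Bigl(\tfrac{d}{ds}\xi^H(a+sb,T\pi(w))\big|_{s=0}\Bigr),\quad w\in T_aE,$$ so that the horizontal lift with respect to it of a vector field $Y$ on $E$ is $Y^{H}(a,b)=(Y(a),B(a,b)Y(a))$. Let $Y$ be a smooth vector field on $E$ that is $\mathrm{Hor}$-basic: $Y$ is projectable (i.e. $\pi$-related to a smooth vector field $X$ on $M$) and $\kappa\circ Y=\eta\circ\pi$ for a smooth section $\eta$ of $E$; in other words, $Y(a)=\xi^H(a,X(\pi(a)))+\xi^V_\pi(a,\eta(\pi(a)))$ for all $a \in E$. Let $\mathcal FY:\pi^*E\to T(\pi^*E)$ be its fibre derivative, the map determined by $\xi^V_{T\pi}\circ\mathcal FY=TY\circ\xi^V_\pi$. **Theorem 6.4.** The horizontal lift of $Y$ with respect to the linearized connection equals the fibre derivative of $Y$: $\;Y^{H}=\mathcal FY$. -/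

import Mathlib

open Bundle Manifold Set Filter Topology
open scoped ContDiff

noncomputable section

set_option linter.unusedSectionVars false

namespace LinearizedConnection

section generic
variable {EN : Type*} [NormedAddCommGroup EN] [NormedSpace ℝ EN]
  {HN : Type*} [TopologicalSpace HN] {J : ModelWithCorners ℝ EN HN}
  {N : Type*} [TopologicalSpace N] [ChartedSpace HN N]
  {EN' : Type*} [NormedAddCommGroup EN'] [NormedSpace ℝ EN']
  {HN' : Type*} [TopologicalSpace HN'] {J' : ModelWithCorners ℝ EN' HN'}
  {N' : Type*} [TopologicalSpace N'] [ChartedSpace HN' N']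

/-- A map whose expression in the preferred charts is `g` has the derivative of `g`. -/
theorem hasMFDerivAt_of_chart {f : N → N'} {x : N} {g : EN → EN'} {L : EN →L[ℝ] EN'}
    (hc : ContinuousAt f x)
    (h : ∀ᶠ q in 𝓝 x, extChartAt J' (f x) (f q) = g (extChartAt J x q))
    (hg : HasFDerivWithinAt g L (range J) (extChartAt J x x)) : HasMFDerivAt J J' f x L := by
  refine ⟨hc, hg.congr_of_eventuallyEq ?_ ?_⟩
  · have ht : Tendsto (extChartAt J x).symm (𝓝[range J] (extChartAt J x x)) (𝓝 x) := by
      have := continuousAt_extChartAt_symm (I := J) x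
      have h2 := this.tendsto
      rw [extChartAt_to_inv] at h2
      exact h2.mono_left nhdsWithin_le_nhds
    filter_upwards [ht.eventually h, extChartAt_target_mem_nhdsWithin (I := J) x] with y hy hy'
    simp only [writtenInExtChartAt, Function.comp_apply]
    rw [hy, (extChartAt J x).right_inv hy']
  · have := h.self_of_nhds
    simp only [writtenInExtChartAt, Function.comp_apply, extChartAt_to_inv]
    exact this

theorem hasMFDerivAt_extChartAt' [IsManifold J 1 N] {p q : N}
    (hq : q ∈ (chartAt HN p).source) :
    HasMFDerivAt J 𝓘(ℝ, EN) (extChartAt J p) q (tangentCoordChange J q p q : EN →L[ℝ] EN) := by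
  have hq' : q ∈ (extChartAt J p).source := by rwa [extChartAt_source]
  refine ⟨continuousAt_extChartAt' hq', ?_⟩
  have := hasFDerivWithinAt_tangentCoordChange (I := J) (x := q) (y := p) (z := q)
    ⟨mem_extChartAt_source q, hq'⟩
  have e : writtenInExtChartAt J 𝓘(ℝ, EN) q (extChartAt J p) =
      extChartAt J p ∘ (extChartAt J q).symm := by
    simp only [writtenInExtChartAt, extChartAt_model_space_eq_id]; rfl
  rw [e]
  exact this

theorem extChartAt_tangent [IsManifold J 1 N] (v u : TangentBundle J N) :
    extChartAt J.tangent v u =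
      (extChartAt J v.1 u.1, tangentCoordChange J u.1 v.1 u.1 u.2) := rfl

end generic

section bundle
variable {EB : Type*} [NormedAddCommGroup EB] [NormedSpace ℝ EB]
  {HB : Type*} [TopologicalSpace HB] {I : ModelWithCorners ℝ EB HB}
  {M : Type*} [TopologicalSpace M] [ChartedSpace HB M]
  {F : Type*} [NormedAddCommGroup F] [NormedSpace ℝ F]
  {E : M → Type*} [TopologicalSpace (TotalSpace F E)] [∀ m, TopologicalSpace (E m)]
  [∀ m, AddCommMonoid (E m)] [∀ m, Module ℝ (E m)]
  [FiberBundle F E] 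

theorem extChartAt_bundle {p q : TotalSpace F E}
    (hq : q.proj ∈ (trivializationAt F E p.proj).baseSet) :
    extChartAt (I.prod 𝓘(ℝ, F)) p q =
      (extChartAt I p.proj q.proj, (trivializationAt F E p.proj q).2) := by
  rw [FiberBundle.extChartAt]
  simp only [PartialEquiv.coe_trans, Function.comp_apply, PartialEquiv.prod_coe,
    PartialEquiv.refl_coe, id_eq]
  have h1 : (trivializationAt F E p.proj q).1 = q.proj :=
    (trivializationAt F E p.proj).coe_fst' hq
  exact Prod.ext (congrArg (extChartAt I p.proj) h1) rfl

theorem mem_baseSet_of_chart {p q : TotalSpace F E}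
    (hq : q ∈ (chartAt (ModelProd HB F) p).source) :
    q.proj ∈ (trivializationAt F E p.proj).baseSet := by
  rw [FiberBundle.chartedSpace_chartAt] at hq
  exact ((trivializationAt F E p.proj).mem_source).1 hq.1

theorem eventually_baseSet (p : TotalSpace F E) :
    ∀ᶠ q in 𝓝 p, q.proj ∈ (trivializationAt F E p.proj).baseSet :=
  (FiberBundle.continuous_proj F E).continuousAt.eventually
    ((trivializationAt F E p.proj).open_baseSet.mem_nhds (mem_baseSet_trivializationAt F E p.proj))

theorem hasMFDerivAt_proj (p : TotalSpace F E) :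
    HasMFDerivAt (I.prod 𝓘(ℝ, F)) I (TotalSpace.proj : TotalSpace F E → M) p
      (ContinuousLinearMap.fst ℝ EB F) := by
  refine hasMFDerivAt_of_chart (g := Prod.fst) (FiberBundle.continuous_proj F E).continuousAt
    ?_ hasFDerivWithinAt_fst
  filter_upwards [eventually_baseSet p] with q hq
  rw [extChartAt_bundle hq]

variable [VectorBundle ℝ F E] [IsManifold I ∞ M] [ContMDiffVectorBundle ∞ F E I]

theorem tangentCoordChange_fst (p q : TotalSpace F E)
    (hq : q ∈ (chartAt (ModelProd HB F) p).source) (w : EB × F) :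
    (tangentCoordChange (I.prod 𝓘(ℝ, F)) q p q w).1 =
      tangentCoordChange I q.proj p.proj q.proj w.1 := by
  have hq' : q ∈ (extChartAt (I.prod 𝓘(ℝ, F)) p).source := by rwa [extChartAt_source]
  have h1 : q.proj ∈ (trivializationAt F E p.proj).baseSet := mem_baseSet_of_chart hq
  have hb : q.proj ∈ (chartAt HB p.proj).source := by
    rw [FiberBundle.chartedSpace_chartAt] at hq
    have h2 := hq.2
    simpa [(trivializationAt F E p.proj).coe_fst' h1] using h2
  have hbs : ∀ᶠ r in 𝓝 q, r ∈ (extChartAt (I.prod 𝓘(ℝ, F)) p).source :=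
    (isOpen_extChartAt_source p).mem_nhds hq'
  -- compare the derivatives of the two sides of `fst ∘ chart = chart ∘ proj`
  have e1 : HasMFDerivAt (I.prod 𝓘(ℝ, F)) 𝓘(ℝ, EB) (fun r => (extChartAt (I.prod 𝓘(ℝ, F)) p r).1) q
      ((ContinuousLinearMap.fst ℝ EB F).comp (tangentCoordChange (I.prod 𝓘(ℝ, F)) q p q)) := by
    have := hasMFDerivAt_extChartAt' (J := I.prod 𝓘(ℝ, F)) hq
    exact HasMFDerivAt.comp q (g := (Prod.fst : EB × F → EB)) (I' := 𝓘(ℝ, EB × F))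
      (hasFDerivAt_fst.hasMFDerivAt) this
  have e2 : HasMFDerivAt (I.prod 𝓘(ℝ, F)) 𝓘(ℝ, EB) (fun r => extChartAt I p.proj r.proj) q
      ((tangentCoordChange I q.proj p.proj q.proj).comp (ContinuousLinearMap.fst ℝ EB F)) := by
    have := hasMFDerivAt_extChartAt' (J := I) hb
    exact HasMFDerivAt.comp q this (hasMFDerivAt_proj q)
  have e3 := e2.congr_of_eventuallyEq (f₁ := fun r => (extChartAt (I.prod 𝓘(ℝ, F)) p r).1) (by
    filter_upwards [hbs] with r hr
    have : r.proj ∈ (trivializationAt F E p.proj).baseSet := by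
      rw [extChartAt_source] at hr
      exact mem_baseSet_of_chart hr
    rw [extChartAt_bundle this])
  have := hasMFDerivAt_unique e1 e3
  exact DFunLike.congr_fun this w

theorem tangentMap_proj_eq (w : TangentBundle (I.prod 𝓘(ℝ, F)) (TotalSpace F E)) :
    tangentMap (I.prod 𝓘(ℝ, F)) I TotalSpace.proj w = ⟨w.1.proj, w.2.1⟩ := by
  have := (hasMFDerivAt_proj (I := I) w.1).mfderiv
  simp only [tangentMap, this]
  rfl

theorem hasMFDerivAt_tangentMap_proj (v : TangentBundle (I.prod 𝓘(ℝ, F)) (TotalSpace F E)) :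
    HasMFDerivAt (I.prod 𝓘(ℝ, F)).tangent I.tangent
      (tangentMap (I.prod 𝓘(ℝ, F)) I (TotalSpace.proj : TotalSpace F E → M)) v
      ((ContinuousLinearMap.fst ℝ EB F).prodMap (ContinuousLinearMap.fst ℝ EB F)) := by
  refine hasMFDerivAt_of_chart (g := Prod.map Prod.fst Prod.fst) ?_ ?_ ?_
  · exact ((contMDiff_proj (n := ∞) E).continuous_tangentMap (by simp)).continuousAt
  · have h0 : ∀ᶠ u in 𝓝 v, u.proj ∈ (chartAt (ModelProd HB F) v.proj).source :=
      (FiberBundle.continuous_proj (EB × F) (TangentSpace (I.prod 𝓘(ℝ, F)))).continuousAt.eventually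
        ((chartAt (ModelProd HB F) v.proj).open_source.mem_nhds (mem_chart_source _ _))
    filter_upwards [h0] with u hu
    rw [extChartAt_tangent, extChartAt_tangent, tangentMap_proj_eq, tangentMap_proj_eq]
    have hb : u.proj.proj ∈ (trivializationAt F E v.proj.proj).baseSet := mem_baseSet_of_chart hu
    refine Prod.ext ?_ ?_
    · change _ = (extChartAt (I.prod 𝓘(ℝ, F)) v.proj u.proj).1
      rw [extChartAt_bundle hb]
    · exact (tangentCoordChange_fst v.proj u.proj hu u.2).symm
  · exact ((ContinuousLinearMap.fst ℝ EB F).prodMap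
      (ContinuousLinearMap.fst ℝ EB F)).hasFDerivWithinAt

end bundle

section pullback
variable {EB : Type*} [NormedAddCommGroup EB] [NormedSpace ℝ EB]
  {HB : Type*} [TopologicalSpace HB] (I : ModelWithCorners ℝ EB HB)
  {M : Type*} [TopologicalSpace M] [ChartedSpace HB M] [IsManifold I ∞ M]
  (F : Type*) [NormedAddCommGroup F] [NormedSpace ℝ F]
  (E : M → Type*) [TopologicalSpace (TotalSpace F E)] [∀ m, TopologicalSpace (E m)]
  [∀ m, AddCommGroup (E m)] [∀ m, Module ℝ (E m)]
  [FiberBundle F E] [VectorBundle ℝ F E] [ContMDiffVectorBundle ∞ F E I]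

/-- The projection `π : E → M` of a smooth vector bundle, as a smooth map. -/
abbrev bundleProj : ContMDiffMap (I.prod 𝓘(ℝ, F)) I (TotalSpace F E) M ∞ :=
  ⟨TotalSpace.proj, contMDiff_proj E⟩

/-- The total space `π^*E` of the pullback of the vector bundle `π : E → M` by its own projection.
A point `p` is a pair `(a, b)` with `a = p.proj : E` and `b = p.snd` in the fibre through `a`. -/
abbrev PullbackTotal : Type _ := TotalSpace F (bundleProj I F E *ᵖ E)

/-- The model with corners of the total space `E`. -/
abbrev totalModel : ModelWithCorners ℝ (EB × F) (ModelProd HB F) := I.prod 𝓘(ℝ, F)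
/-- The model with corners of the total space `π^*E`. -/
abbrev pullbackModel : ModelWithCorners ℝ ((EB × F) × F) (ModelProd (ModelProd HB F) F) :=
  (totalModel I F).prod 𝓘(ℝ, F)

/-- The tangent bundle `TE` of the total space `E`. -/
abbrev TE := TangentBundle (totalModel I F) (TotalSpace F E)
/-- The tangent bundle `T(π^*E)`. -/
abbrev TPullback := TangentBundle (pullbackModel I F) (PullbackTotal I F E)
/-- The double tangent bundle `T(TE)`. -/
abbrev TTE := TangentBundle (totalModel I F).tangent (TE I F E)

variable {I F E}
/-- The second component `b ∈ E_{π(a)}` of `(a, b) ∈ π^*E`. -/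
abbrev PullbackTotal.vec (p : PullbackTotal I F E) : E p.proj.proj := p.snd

variable (I)

/-- The map `(a, b) ↦ a + s b` from `π^*E` to `E`. -/
def fibreSum (s : ℝ) (p : PullbackTotal I F E) : TotalSpace F E :=
  ⟨p.proj.proj, p.proj.snd + s • p.vec⟩

/-- The map `pr₂ : π^*E → E`, `(a, b) ↦ b`. (The map `pr₁`, `(a, b) ↦ a`, is the projection
`TotalSpace.proj` of the pullback bundle.) -/
def fibreSnd (p : PullbackTotal I F E) : TotalSpace F E := ⟨p.proj.proj, p.vec⟩

/-- The map `(a, b) ↦ α a + β b`, used to treat `fibreSum` and `fibreSnd` together. -/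
def linComb (α β : ℝ) (p : PullbackTotal I F E) : TotalSpace F E :=
  ⟨p.proj.proj, α • p.proj.snd + β • p.vec⟩

variable {I}

theorem fibreSum_eq (s : ℝ) : (fibreSum I s : PullbackTotal I F E → _) = linComb I 1 s := by
  ext p : 1; simp [fibreSum, linComb]

theorem fibreSnd_eq : (fibreSnd I : PullbackTotal I F E → _) = linComb I 0 1 := by
  ext p : 1; simp [fibreSnd, linComb]

theorem triv_linComb (α β : ℝ) (p q : PullbackTotal I F E)
    (hq : q.proj.proj ∈ (trivializationAt F E p.proj.proj).baseSet) :
    (trivializationAt F E p.proj.proj (linComb I α β q)).2 =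
      α • (trivializationAt F E p.proj.proj q.proj).2 +
      β • (trivializationAt F (bundleProj I F E *ᵖ E) p.proj q).2 := by
  have h := (trivializationAt F E p.proj.proj).linear ℝ hq
  have h1 := h.map_add (α • q.proj.snd) (β • q.vec)
  have h2 := h.map_smul α q.proj.snd
  have h3 := h.map_smul β q.vec
  exact h1.trans (congrArg₂ (· + ·) h2 h3)

theorem extChartAt_pullback (p q : PullbackTotal I F E)
    (hq : q.proj.proj ∈ (trivializationAt F E p.proj.proj).baseSet) :
    extChartAt (pullbackModel I F) p q = (extChartAt (totalModel I F) p.proj q.proj,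
      (trivializationAt F (bundleProj I F E *ᵖ E) p.proj q).2) :=
  extChartAt_bundle (I := totalModel I F) (E := bundleProj I F E *ᵖ E) hq

/-- The expression of `linComb` in bundle charts. -/
def linCombL (α β : ℝ) : ((EB × F) × F) →L[ℝ] (EB × F) :=
  ((ContinuousLinearMap.fst ℝ EB F).comp (ContinuousLinearMap.fst ℝ (EB × F) F)).prod
    (α • ((ContinuousLinearMap.snd ℝ EB F).comp (ContinuousLinearMap.fst ℝ (EB × F) F)) +
     β • ContinuousLinearMap.snd ℝ (EB × F) F)

theorem extChartAt_linComb (α β : ℝ) (a : TotalSpace F E) (p q : PullbackTotal I F E)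
    (ha : a.proj = p.proj.proj)
    (hq : q.proj.proj ∈ (trivializationAt F E p.proj.proj).baseSet) :
    extChartAt (totalModel I F) a (linComb I α β q) =
      linCombL α β (extChartAt (pullbackModel I F) p q) := by
  have hq' : (linComb I α β q).proj ∈ (trivializationAt F E a.proj).baseSet := by rw [ha]; exact hq
  rw [extChartAt_pullback p q hq, extChartAt_bundle hq', extChartAt_bundle hq, ha,
    triv_linComb α β p q hq]
  rfl

theorem continuous_fibreSnd :
    Continuous (fibreSnd I : PullbackTotal I F E → TotalSpace F E) :=
  Pullback.continuous_lift F E (bundleProj I F E)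

theorem continuous_triv_pullback (p : PullbackTotal I F E) :
    ContinuousAt (fun q : PullbackTotal I F E =>
      (trivializationAt F (bundleProj I F E *ᵖ E) p.proj q).2) p := by
  have := (FiberBundle.continuousAt_totalSpace F (E := bundleProj I F E *ᵖ E)
    (f := (id : PullbackTotal I F E → _)) (x₀ := p)).1 continuousAt_id
  exact this.2

theorem continuousAt_linComb (α β : ℝ) (p : PullbackTotal I F E) :
    ContinuousAt (linComb I α β) p := by
  have hp : ContinuousAt (fun q : PullbackTotal I F E => q.proj) p :=
    (FiberBundle.continuous_proj F (bundleProj I F E *ᵖ E)).continuousAt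
  have hp' := (FiberBundle.continuousAt_totalSpace F (f := fun q : PullbackTotal I F E => q.proj) (x₀ := p)).1 hp
  rw [FiberBundle.continuousAt_totalSpace]
  refine ⟨hp'.1, ?_⟩
  have h : ∀ᶠ q : PullbackTotal I F E in 𝓝 p,
      q.proj.proj ∈ (trivializationAt F E p.proj.proj).baseSet :=
    hp'.1.eventually ((trivializationAt F E p.proj.proj).open_baseSet.mem_nhds
      (mem_baseSet_trivializationAt F E p.proj.proj))
  refine ContinuousAt.congr (f := fun q => α • (trivializationAt F E p.proj.proj q.proj).2 +
      β • (trivializationAt F (bundleProj I F E *ᵖ E) p.proj q).2) ?_ ?_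
  · exact (hp'.2.const_smul α).add ((continuous_triv_pullback p).const_smul β)
  · filter_upwards [h] with q hq
    exact (triv_linComb α β p q hq).symm

theorem hasMFDerivAt_linComb (α β : ℝ) (p : PullbackTotal I F E) :
    HasMFDerivAt (pullbackModel I F) (totalModel I F) (linComb I α β) p (linCombL α β) := by
  refine hasMFDerivAt_of_chart (g := linCombL α β) (continuousAt_linComb α β p) ?_
    (ContinuousLinearMap.hasFDerivWithinAt (linCombL (EB := EB) (F := F) α β))
  filter_upwards [eventually_baseSet (E := bundleProj I F E *ᵖ E) p] with q hq
  exact extChartAt_linComb α β _ p q rfl hq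

theorem tangentMap_linComb (α β : ℝ) (u : TPullback I F E) :
    tangentMap (pullbackModel I F) (totalModel I F) (linComb I α β) u =
      ⟨linComb I α β u.1, (linCombL α β u.2 : EB × F)⟩ := by
  have := (hasMFDerivAt_linComb (I := I) α β u.1).mfderiv
  simp only [tangentMap, this]
  rfl

/-- The preferred charts at two points of the same fibre agree. -/
theorem tangentCoordChange_fibre (a a' : TotalSpace F E) (h : a'.proj = a.proj) (w : EB × F) :
    tangentCoordChange (totalModel I F) a' a a' w = w := by
  have h1 : achart (ModelProd HB F) a' = achart (ModelProd HB F) a := by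
    apply Subtype.ext
    change chartAt (ModelProd HB F) a' = chartAt (ModelProd HB F) a
    rw [FiberBundle.chartedSpace_chartAt, FiberBundle.chartedSpace_chartAt, h]
  have := tangentCoordChange_self (I := totalModel I F) (x := a') (z := a') (v := w)
    (mem_extChartAt_source _)
  unfold tangentCoordChange at this ⊢
  rwa [← h1]

/-- The coordinate of `b` in the fibre. -/
abbrev fibreCoord (p : PullbackTotal I F E) : F :=
  (trivializationAt F (bundleProj I F E *ᵖ E) p.proj p).2

theorem hasFDerivAt_linCombL (c : (EB × F) × F) (s : ℝ) :
    HasFDerivAt (fun s : ℝ => linCombL 1 s c)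
      (ContinuousLinearMap.toSpanSingleton ℝ ((0, c.2) : EB × F)) s := by
  have h : HasDerivAt (fun s : ℝ => linCombL 1 s c) ((0, c.2) : EB × F) s := by
    have h1 : HasDerivAt (fun _ : ℝ => c.1.1) 0 s := hasDerivAt_const _ _
    have h2 : HasDerivAt (fun s : ℝ => (1 : ℝ) • c.1.2 + s • c.2) c.2 s := by
      simpa using ((hasDerivAt_id s).smul_const c.2).const_add ((1 : ℝ) • c.1.2)
    exact h1.prodMk h2
  exact h.hasFDerivAt

theorem continuous_curve (p : PullbackTotal I F E) :
    Continuous (fun s : ℝ => linComb I 1 s p) := by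
  rw [continuous_iff_continuousAt]
  intro s0
  rw [FiberBundle.continuousAt_totalSpace]
  refine ⟨continuousAt_const, ?_⟩
  have : ∀ s, (trivializationAt F E p.proj.proj (linComb I 1 s p)).2 = _ := fun s =>
    triv_linComb 1 s p p (mem_baseSet_trivializationAt F E _)
  change ContinuousAt (fun s => (trivializationAt F E p.proj.proj (linComb I 1 s p)).2) s0
  simp only [this]
  fun_prop

theorem hasMFDerivAt_curve (p : PullbackTotal I F E) :
    HasMFDerivAt 𝓘(ℝ, ℝ) (totalModel I F) (fun s : ℝ => linComb I 1 s p) 0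
      (ContinuousLinearMap.toSpanSingleton ℝ ((0, fibreCoord p) : EB × F)) := by
  refine hasMFDerivAt_of_chart (g := fun s => linCombL 1 s (extChartAt (pullbackModel I F) p p))
    (continuous_curve p).continuousAt (Eventually.of_forall fun s => ?_) ?_
  · exact extChartAt_linComb 1 s _ p p rfl (mem_baseSet_trivializationAt F E _)
  · rw [extChartAt_pullback p p (mem_baseSet_trivializationAt F E _)]
    exact (hasFDerivAt_linCombL _ _).hasFDerivWithinAt

theorem hasMFDerivAt_tangentCurve (u : TPullback I F E) :
    HasMFDerivAt 𝓘(ℝ, ℝ) (totalModel I F).tangent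
      (fun s : ℝ => tangentMap (pullbackModel I F) (totalModel I F) (linComb I 1 s) u) 0
      (ContinuousLinearMap.toSpanSingleton ℝ
        (((0, fibreCoord u.1), (0, u.2.2)) : (EB × F) × (EB × F))) := by
  have hchart : ∀ s0 s : ℝ, tangentCoordChange (totalModel I F) (linComb I 1 s u.1)
      (linComb I 1 s0 u.1) (linComb I 1 s u.1) (linCombL 1 s u.2 : EB × F) =
      linCombL 1 s u.2 := fun s0 s =>
    tangentCoordChange_fibre (linComb I 1 s0 u.1) (linComb I 1 s u.1) rfl (linCombL 1 s u.2)
  refine hasMFDerivAt_of_chart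
    (g := fun s => (linCombL 1 s (extChartAt (pullbackModel I F) u.1 u.1), linCombL 1 s u.2))
    ?_ (Eventually.of_forall fun s => ?_) ?_
  · simp only [tangentMap_linComb]
    rw [FiberBundle.continuousAt_totalSpace]
    refine ⟨(continuous_curve u.1).continuousAt, ?_⟩
    change ContinuousAt (fun s => tangentCoordChange (totalModel I F) (linComb I 1 s u.1)
      (linComb I 1 0 u.1) (linComb I 1 s u.1) (linCombL 1 s u.2 : EB × F)) 0
    simp only [hchart]
    exact (hasFDerivAt_linCombL u.2 0).continuousAt
  · rw [tangentMap_linComb, tangentMap_linComb, extChartAt_tangent]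
    have h1 := extChartAt_linComb 1 s (linComb I 1 0 u.1) u.1 u.1 rfl
      (mem_baseSet_trivializationAt F E _)
    exact congrArg₂ Prod.mk h1 (hchart 0 s)
  · rw [extChartAt_pullback u.1 u.1 (mem_baseSet_trivializationAt F E _)]
    have h := (hasFDerivAt_linCombL (extChartAt (totalModel I F) u.1.proj u.1.proj,
      fibreCoord u.1) (0 : ℝ)).prodMk (hasFDerivAt_linCombL u.2 0)
    refine HasFDerivAt.hasFDerivWithinAt ?_
    convert! h using 1

/-- The vector tangent at `s = 0` to a curve `s ↦ γ s`. -/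
def velocity {EN : Type*} [NormedAddCommGroup EN] [NormedSpace ℝ EN]
    {HN : Type*} [TopologicalSpace HN] (J : ModelWithCorners ℝ EN HN)
    {N : Type*} [TopologicalSpace N] [ChartedSpace HN N] (γ : ℝ → N) : TangentBundle J N :=
  ⟨γ 0, mfderiv 𝓘(ℝ, ℝ) J γ 0 (1 : ℝ)⟩

theorem velocity_eq {EN : Type*} [NormedAddCommGroup EN] [NormedSpace ℝ EN]
    {HN : Type*} [TopologicalSpace HN] {J : ModelWithCorners ℝ EN HN}
    {N : Type*} [TopologicalSpace N] [ChartedSpace HN N] {γ : ℝ → N} {v : EN}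
    (h : HasMFDerivAt 𝓘(ℝ, ℝ) J γ 0 (ContinuousLinearMap.toSpanSingleton ℝ v)) :
    velocity J γ = ⟨γ 0, v⟩ := by
  have h2 : mfderiv 𝓘(ℝ, ℝ) J γ 0 (1 : ℝ) = v := by
    rw [h.mfderiv]
    exact (ContinuousLinearMap.toSpanSingleton_apply_one (R₁ := ℝ) v)
  exact congrArg (fun z => (⟨γ 0, z⟩ : TangentBundle J N)) h2

variable (I)
/-- The vertical lifting `ξ_π^V(a, b) = d/ds (a + s b)` at `s = 0`, as a map `π^*E → TE`. -/
def verticalLift (p : PullbackTotal I F E) : TE I F E :=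
  velocity (totalModel I F) (fun s => fibreSum I s p)

/-- The vertical lifting of the vector bundle `Tπ : TE → TM`, as a map `T(π^*E) → T(TE)`.
If `u` is the tangent vector to `π^*E` that corresponds to the pair `(v, w)` with `Tπ v = Tπ w`, then
applying to `u` the tangent map of `(a, b) ↦ a + s b` gives the combination of `v` and `w`
with coefficients `1` and `s` for the operations of `Tπ : TE → TM` (these are by definition the
tangent maps of the operations of `E`), and the vertical lift is the derivative of this
combination with respect to `s` at `s = 0`. -/
def verticalLiftT (u : TPullback I F E) : TTE I F E :=
  velocity (totalModel I F).tangent (fun s => tangentMap (pullbackModel I F) (totalModel I F) (fibreSum I s) u)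

/-- The map `Tπ : TE → TM`. -/
def tangentProj : TE I F E → TangentBundle I M :=
  tangentMap (totalModel I F) I TotalSpace.proj

variable (F E) in
/-- The vertical bundle `Ver(π) = Ker(Tπ)`. -/
def Ver : Set (TE I F E) := {w | (tangentProj I w).snd = 0}

variable (F E) in
/-- The vertical bundle `Ver(Tπ) = Ker(TTπ)` of `Tπ : TE → TM`. -/
def VerT : Set (TTE I F E) :=
   {V | (tangentMap (totalModel I F).tangent I.tangent (tangentProj I) V).snd = 0}

variable (F E) in
/-- The pullback `(Tπ)^*(TE)`: the pairs `(w, w')` in `TE × TE` with `Tπ w = Tπ w'`. -/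
def TangentPairs : Set (TE I F E × TE I F E) := {w | tangentProj I w.1 = tangentProj I w.2}

variable {I}

theorem tangentProj_eq (w : TE I F E) : tangentProj I w = ⟨w.1.proj, w.2.1⟩ :=
  tangentMap_proj_eq w

theorem linComb_one_zero (p : PullbackTotal I F E) : linComb I 1 0 p = p.proj := by
  simp [linComb]

theorem TE_ext {w w' : TE I F E} (h : w.1 = w'.1) (h2 : (w.2 : EB × F) = w'.2) : w = w' := by
  obtain ⟨a, w⟩ := w; obtain ⟨a', w'⟩ := w'
  dsimp at h; subst h
  exact congrArg _ h2

theorem TPullback_ext {u u' : TPullback I F E} (h : u.1 = u'.1) (h2 : (u.2 : (EB × F) × F) = u'.2) :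
    u = u' := by
  obtain ⟨a, w⟩ := u; obtain ⟨a', w'⟩ := u'
  dsimp at h; subst h
  exact congrArg _ h2

theorem TTE_ext {V V' : TTE I F E} (h : V.1 = V'.1)
    (h2 : (V.2 : (EB × F) × (EB × F)) = V'.2) : V = V' := by
  obtain ⟨a, w⟩ := V; obtain ⟨a', w'⟩ := V'
  dsimp at h; subst h
  exact congrArg _ h2

theorem linCombL_one_zero (c : (EB × F) × F) : linCombL 1 0 c = c.1 := by
  simp [linCombL]

theorem linCombL_zero_one (c : (EB × F) × F) : linCombL 0 1 c = (c.1.1, c.2) := by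
  simp [linCombL]

theorem TE_congr {a a' : TotalSpace F E} (h : a = a') (w : EB × F) :
    (⟨a, w⟩ : TE I F E) = ⟨a', w⟩ := by subst h; rfl

theorem TTE_congr {v v' : TE I F E} (h : v = v') (w : (EB × F) × (EB × F)) :
    (⟨v, w⟩ : TTE I F E) = ⟨v', w⟩ := by subst h; rfl

theorem verticalLift_eq (p : PullbackTotal I F E) :
    verticalLift I p = ⟨p.proj, ((0, fibreCoord p) : EB × F)⟩ := by
  have e : (fun s => fibreSum I s p) = fun s => linComb I 1 s p :=
    funext fun s => congrFun (fibreSum_eq s) p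
  rw [verticalLift, e, velocity_eq (hasMFDerivAt_curve p)]
  exact TE_congr (linComb_one_zero p) _

theorem verticalLiftT_eq (u : TPullback I F E) :
    verticalLiftT I u = ⟨⟨u.1.proj, (u.2.1 : EB × F)⟩,
      (((0, fibreCoord u.1), (0, u.2.2)) : (EB × F) × (EB × F))⟩ := by
  have e : (fun s => tangentMap (pullbackModel I F) (totalModel I F) (fibreSum I s) u) =
      fun s => tangentMap (pullbackModel I F) (totalModel I F) (linComb I 1 s) u :=
    funext fun s => by rw [fibreSum_eq]
  have h0 : tangentMap (pullbackModel I F) (totalModel I F) (linComb I 1 0) u =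
      ⟨u.1.proj, (u.2.1 : EB × F)⟩ := by
    rw [tangentMap_linComb]
    refine TE_ext (linComb_one_zero u.1) ?_
    exact linCombL_one_zero u.2
  rw [verticalLiftT, e, velocity_eq (hasMFDerivAt_tangentCurve u)]
  exact TTE_congr h0 _

theorem mem_Ver (w : TE I F E) : w ∈ Ver I F E ↔ w.2.1 = 0 := by
  change (tangentProj I w).snd = 0 ↔ _
  rw [tangentProj_eq]; rfl

theorem mem_VerT (V : TTE I F E) : V ∈ VerT I F E ↔ V.2.1.1 = 0 ∧ V.2.2.1 = 0 := by
  have h := (hasMFDerivAt_tangentMap_proj (I := I) (F := F) (E := E) V.1).mfderiv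
  change mfderiv _ _ (tangentMap (totalModel I F) I TotalSpace.proj) V.1 V.2 = 0 ↔ _
  rw [h]
  exact Prod.ext_iff

theorem fibreCoord_inj {a : TotalSpace F E} {b b' : E a.proj}
    (h : fibreCoord (I := I) (⟨a, b⟩ : PullbackTotal I F E) =
      fibreCoord (I := I) (⟨a, b'⟩ : PullbackTotal I F E)) : b = b' := by
  obtain ⟨m, a⟩ := a
  have hm := mem_baseSet_trivializationAt F E m
  exact ((trivializationAt F E m).linearEquivAt ℝ m hm).injective
    (((trivializationAt F E m).linearEquivAt_apply m hm b).trans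
      (h.trans ((trivializationAt F E m).linearEquivAt_apply m hm b').symm))

theorem fibreCoord_surj (a : TotalSpace F E) (y : F) :
    ∃ b : E a.proj, fibreCoord (I := I) (⟨a, b⟩ : PullbackTotal I F E) = y :=
  ⟨(trivializationAt F E a.proj).symm a.proj y, congrArg Prod.snd
    ((trivializationAt F E a.proj).apply_mk_symm (mem_baseSet_trivializationAt F E a.proj) y)⟩

theorem verticalLift_mem (p : PullbackTotal I F E) : verticalLift I p ∈ Ver I F E := by
  rw [mem_Ver, verticalLift_eq]

theorem verticalLiftT_mem (u : TPullback I F E) : verticalLiftT I u ∈ VerT I F E := by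
  rw [mem_VerT, verticalLiftT_eq]; exact ⟨rfl, rfl⟩

theorem TE_snd {w w' : TE I F E} (h : w = w') : (w.2 : EB × F) = w'.2 := by subst h; rfl
theorem TTE_snd {w w' : TTE I F E} (h : w = w') : (w.2 : (EB × F) × (EB × F)) = w'.2 := by
  subst h; rfl

theorem pullback_ext {p q : PullbackTotal I F E} (h : p.proj = q.proj)
    (h2 : fibreCoord p = fibreCoord q) : p = q := by
  obtain ⟨a, b⟩ := p; obtain ⟨a', b'⟩ := q
  dsimp only at h; subst h
  rw [fibreCoord_inj (I := I) (b := b) (b' := b') h2]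

theorem verticalLift_bijective :
    Function.Bijective (fun p : PullbackTotal I F E =>
      (⟨verticalLift I p, verticalLift_mem p⟩ : Ver I F E)) := by
  constructor
  · intro p q h
    have h := congrArg Subtype.val h
    dsimp only at h
    rw [verticalLift_eq, verticalLift_eq] at h
    have h2 := TE_snd h
    exact pullback_ext (congrArg (fun w : TE I F E => w.proj) h) (congrArg (fun z : EB × F => z.2) h2)
  · rintro ⟨w, hw⟩
    obtain ⟨b, hb⟩ := fibreCoord_surj (I := I) w.1 w.2.2
    refine ⟨⟨w.1, b⟩, Subtype.ext ?_⟩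
    dsimp only
    rw [verticalLift_eq]
    exact TE_ext rfl (Prod.ext ((mem_Ver w).1 hw).symm hb)

theorem verticalLiftT_bijective :
    Function.Bijective (fun u : TPullback I F E =>
      (⟨verticalLiftT I u, verticalLiftT_mem u⟩ : VerT I F E)) := by
  constructor
  · intro u u' h
    have h := congrArg Subtype.val h
    dsimp only at h
    rw [verticalLiftT_eq, verticalLiftT_eq] at h
    have h1 := congrArg (fun w : TTE I F E => w.proj) h
    have h2 := TTE_snd h
    have h3 := TE_snd h1
    exact TPullback_ext (pullback_ext (congrArg (fun w : TE I F E => w.proj) h1)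
      (congrArg (fun z : (EB × F) × (EB × F) => z.1.2) h2))
      (Prod.ext h3 (congrArg (fun z : (EB × F) × (EB × F) => z.2.2) h2))
  · rintro ⟨V, hV⟩
    obtain ⟨b, hb⟩ := fibreCoord_surj (I := I) V.1.1 V.2.1.2
    refine ⟨⟨⟨V.1.1, b⟩, ((V.1.2, V.2.2.2) : (EB × F) × F)⟩, Subtype.ext ?_⟩
    dsimp only
    rw [verticalLiftT_eq]
    have := (mem_VerT V).1 hV
    exact TTE_ext rfl (Prod.ext (Prod.ext this.1.symm hb) (Prod.ext this.2.symm rfl))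

theorem tangentMap_fst (u : TPullback I F E) :
    tangentMap (pullbackModel I F) (totalModel I F) TotalSpace.proj u = ⟨u.1.proj, (u.2.1 : EB × F)⟩ :=
  tangentMap_proj_eq (I := totalModel I F) (E := bundleProj I F E *ᵖ E) u

theorem tangentMap_fibreSnd (u : TPullback I F E) :
    tangentMap (pullbackModel I F) (totalModel I F) (fibreSnd I) u =
      ⟨⟨u.1.proj.proj, u.1.vec⟩, ((u.2.1.1, u.2.2) : EB × F)⟩ := by
  rw [fibreSnd_eq, tangentMap_linComb]
  refine TE_ext ?_ ?_
  · simp [linComb]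
  · exact linCombL_zero_one u.2

theorem tangentPair_mem (u : TPullback I F E) :
    (tangentMap (pullbackModel I F) (totalModel I F) TotalSpace.proj u,
      tangentMap (pullbackModel I F) (totalModel I F) (fibreSnd I) u) ∈ TangentPairs I F E := by
  change tangentProj I _ = tangentProj I _
  rw [tangentMap_fst, tangentMap_fibreSnd, tangentProj_eq, tangentProj_eq]

theorem tangentPair_bijective :
    Function.Bijective (fun u : TPullback I F E =>
      (⟨(tangentMap (pullbackModel I F) (totalModel I F) TotalSpace.proj u,
      tangentMap (pullbackModel I F) (totalModel I F) (fibreSnd I) u), tangentPair_mem u⟩ :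
      TangentPairs I F E)) := by
  constructor
  · intro u u' h
    have h := congrArg Subtype.val h
    have h1 := congrArg Prod.fst h
    have h2 := congrArg Prod.snd h
    dsimp only at h1 h2
    rw [tangentMap_fst, tangentMap_fst] at h1
    rw [tangentMap_fibreSnd, tangentMap_fibreSnd] at h2
    have h3 := congrArg (fun w : TE I F E => w.proj) h1
    have h4 := congrArg (fun w : TE I F E => w.proj) h2
    have h5 := TE_snd h1
    have h6 := TE_snd h2
    refine TPullback_ext ?_ (Prod.ext h5 (congrArg (fun z : EB × F => z.2) h6))
    obtain ⟨⟨a, b⟩, _⟩ := u; obtain ⟨⟨a', b'⟩, _⟩ := u'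
    dsimp only at h3; subst h3
    have h7 : PullbackTotal.vec (⟨a, b⟩ : PullbackTotal I F E) =
      PullbackTotal.vec (⟨a, b'⟩ : PullbackTotal I F E) := by simpa using h4
    exact congrArg (fun z => (⟨a, z⟩ : PullbackTotal I F E)) h7
  · rintro ⟨⟨⟨⟨m, a⟩, w⟩, ⟨⟨m', b⟩, w'⟩⟩, hw⟩
    change tangentProj I _ = tangentProj I _ at hw
    rw [tangentProj_eq, tangentProj_eq] at hw
    have hm : m = m' := congrArg TotalSpace.proj hw
    subst hm
    have hx : w.1 = w'.1 := by
      have := (TotalSpace.mk_inj (F := EB) (E := (TangentSpace I : M → Type _))).1 hw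
      exact this
    refine ⟨⟨⟨⟨m, a⟩, b⟩, ((w, w'.2) : (EB × F) × F)⟩, Subtype.ext (Prod.ext ?_ ?_)⟩
    · dsimp only
      rw [tangentMap_fst]
    · dsimp only
      rw [tangentMap_fibreSnd]
      exact TE_ext rfl (Prod.ext hx rfl)

/-- The vertical lifting as a bijection `π^*E ≃ Ver(π)`. -/
def verticalLiftEquiv : PullbackTotal I F E ≃ Ver I F E :=
  Equiv.ofBijective _ verticalLift_bijective

/-- The vertical projection `ν_π = pr₂ ∘ (ξ_π^V)⁻¹ : Ver(π) → E`. -/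
def verticalProj (w : Ver I F E) : TotalSpace F E := fibreSnd I (verticalLiftEquiv.symm w)

/-- The vertical lifting of `Tπ` as a bijection `T(π^*E) ≃ Ver(Tπ)`. -/
def verticalLiftTEquiv : TPullback I F E ≃ VerT I F E :=
  Equiv.ofBijective _ verticalLiftT_bijective

/-- The vertical projection `ν_{Tπ} = pr₂ ∘ (ξ_{Tπ}^V)⁻¹ : Ver(Tπ) → TE`. -/
def verticalProjT (V : VerT I F E) : TE I F E :=
  tangentMap (pullbackModel I F) (totalModel I F) (fibreSnd I) (verticalLiftTEquiv.symm V)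

/-- The canonical identification `T(π^*E) ≃ (Tπ)^*(TE)`, `u ↦ (T pr₁ u, T pr₂ u)`. -/
def tangentPairEquiv : TPullback I F E ≃ TangentPairs I F E :=
  Equiv.ofBijective _ tangentPair_bijective

theorem tangentProj_verticalProjT (V : VerT I F E) :
    tangentProj I (verticalProjT V) = tangentProj I V.1.proj := by
  obtain ⟨u, rfl⟩ := verticalLiftTEquiv.surjective V
  have h : (verticalLiftTEquiv u).1 = verticalLiftT I u := rfl
  rw [verticalProjT, Equiv.symm_apply_apply, h, verticalLiftT_eq, tangentMap_fibreSnd,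
    tangentProj_eq, tangentProj_eq]

variable (I F E)

/-- A (generally nonlinear) Ehresmann connection on the vector bundle `π : E → M`: a smooth right
splitting `ξ^H : π^*TM → TE` of the fundamental sequence `0 → π^*E → TE → π^*TM → 0`, given by its
values `ξ^H(a, v) ∈ T_a E`, linear in `v ∈ T_{π(a)} M` (no linearity in `a` is required). -/
structure EhresmannConnection where
  lift : ∀ a : TotalSpace F E, TangentSpace I a.proj →L[ℝ] TangentSpace (totalModel I F) a
  mfderiv_proj_lift : ∀ (a : TotalSpace F E) (v : TangentSpace I a.proj),
    mfderiv (totalModel I F) I TotalSpace.proj a (lift a v) = v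
  contMDiff_lift : ContMDiff ((totalModel I F).prod 𝓘(ℝ, EB)) (totalModel I F).tangent ∞
    (fun q : TotalSpace EB (bundleProj I F E *ᵖ (TangentSpace I : M → Type _)) =>
      (⟨q.proj, lift q.proj q.snd⟩ : TE I F E))

/-- Smooth vector fields on `M`. -/
abbrev VectorFieldBase := ContMDiffSection I EB ∞ (TangentSpace I : M → Type _)
/-- Smooth vector fields on the total space `E`. -/
abbrev VectorFieldE := ContMDiffSection (totalModel I F) (EB × F) ∞
  (TangentSpace (totalModel I F) : TotalSpace F E → Type _)
/-- Smooth sections of `π : E → M`. -/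
abbrev BasicSection := ContMDiffSection I F ∞ E

variable {I F E}

/-- A vector field on `E` is projectable if it is `π`-related to a vector field on `M`. -/
def IsProjectable (Y : VectorFieldE I F E) : Prop :=
  ∃ X : VectorFieldBase I (M := M), ∀ a : TotalSpace F E,
    mfderiv (totalModel I F) I TotalSpace.proj a (Y a) = X a.proj

namespace EhresmannConnection

variable (Hor : EhresmannConnection I F E)

/-- The vertical projector `P_V(w) = w - ξ^H(a, Tπ w)` for `w ∈ T_a E`. -/
def verticalPart (w : TE I F E) : TE I F E :=
  ⟨w.proj, w.snd - Hor.lift w.proj (mfderiv (totalModel I F) I TotalSpace.proj w.proj w.snd)⟩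

theorem verticalPart_mem (w : TE I F E) : Hor.verticalPart w ∈ Ver I F E := by
  change mfderiv (totalModel I F) I TotalSpace.proj w.proj
    (w.snd - Hor.lift w.proj (mfderiv (totalModel I F) I TotalSpace.proj w.proj w.snd)) = 0
  rw [map_sub, Hor.mfderiv_proj_lift, sub_self]

/-- The connector (Dombrowski connection map) `κ = ν_π ∘ P_V : TE → E`. -/
def connector (w : TE I F E) : TotalSpace F E :=
  verticalProj ⟨Hor.verticalPart w, Hor.verticalPart_mem w⟩

/-- A vector field `Y` on `E` is `Hor`-basic if it is projectable and `κ(Y)` is a basic section,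
that is, `κ(Y) = η ∘ π` for a smooth section `η` of `E`. -/
def IsHorBasic (Y : VectorFieldE I F E) : Prop :=
  IsProjectable Y ∧ ∃ η : BasicSection I F E, ∀ a : TotalSpace F E,
    Hor.connector ⟨a, Y a⟩ = ⟨a.proj, η a.proj⟩

/-- The curve `s ↦ ξ^H(a + s b, v)` in `TE`, for `p = (a, b)`. -/
def liftCurve (p : PullbackTotal I F E) (v : TangentSpace I p.proj.proj) (s : ℝ) : TE I F E :=
  ⟨fibreSum I s p, Hor.lift (fibreSum I s p) v⟩

theorem tangentProj_liftCurve (p : PullbackTotal I F E) (v : TangentSpace I p.proj.proj) (s : ℝ) :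
    tangentProj I (Hor.liftCurve p v s) = ⟨p.proj.proj, v⟩ :=
  congrArg (fun z : TangentSpace I p.proj.proj => (⟨p.proj.proj, z⟩ : TangentBundle I M))
    (Hor.mfderiv_proj_lift (fibreSum I s p) v)

theorem velocity_liftCurve_mem (p : PullbackTotal I F E) (v : TangentSpace I p.proj.proj) :
    velocity (totalModel I F).tangent (Hor.liftCurve p v) ∈ VerT I F E := by
  by_cases h : MDifferentiableAt 𝓘(ℝ, ℝ) (totalModel I F).tangent (Hor.liftCurve p v) 0
  · have h1 : HasMFDerivAt (totalModel I F).tangent I.tangent (tangentProj I) (Hor.liftCurve p v 0) _ :=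
      hasMFDerivAt_tangentMap_proj (Hor.liftCurve p v 0)
    have h2 := h1.comp (0 : ℝ) h.hasMFDerivAt
    have h3 : tangentProj I ∘ Hor.liftCurve p v = fun _ => ⟨p.proj.proj, v⟩ :=
      funext fun s => Hor.tangentProj_liftCurve p v s
    rw [h3] at h2
    have h4 := hasMFDerivAt_unique h2 (hasMFDerivAt_const _ _)
    have h5 := DFunLike.congr_fun h4 (1 : ℝ)
    change mfderiv (totalModel I F).tangent I.tangent (tangentProj I) (Hor.liftCurve p v 0)
      (mfderiv 𝓘(ℝ, ℝ) (totalModel I F).tangent (Hor.liftCurve p v) 0 (1 : ℝ)) = 0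
    rw [h1.mfderiv]
    exact h5
  · change mfderiv (totalModel I F).tangent I.tangent (tangentProj I) (Hor.liftCurve p v 0)
      (mfderiv 𝓘(ℝ, ℝ) (totalModel I F).tangent (Hor.liftCurve p v) 0 (1 : ℝ)) = 0
    rw [mfderiv_zero_of_not_mdifferentiableAt h]
    exact map_zero _

/-- `B(a, b) w = ν_{Tπ} (d/ds ξ^H(a + s b, Tπ w))` at `s = 0`, for `p = (a, b)` and `w ∈ T_a E`. -/
def linearizedVec (p : PullbackTotal I F E) (w : TangentSpace (totalModel I F) p.proj) : TE I F E :=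
  verticalProjT ⟨_, Hor.velocity_liftCurve_mem p
    (mfderiv (totalModel I F) I TotalSpace.proj p.proj w)⟩

theorem linearizedVec_mem (p : PullbackTotal I F E) (w : TangentSpace (totalModel I F) p.proj) :
    ((⟨p.proj, w⟩ : TE I F E), Hor.linearizedVec p w) ∈ TangentPairs I F E := by
  change tangentProj I _ = tangentProj I _
  rw [linearizedVec, tangentProj_verticalProjT]
  exact (Hor.tangentProj_liftCurve p _ 0).symm

/-- The horizontal lifting of the linearized connection on `π^*E → E`: the vector tangent to `π^*E`
that corresponds to the pair `(w, B(a, b) w)`, for `p = (a, b)` and `w ∈ T_a E`. -/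
def linearizedLift (p : PullbackTotal I F E) (w : TangentSpace (totalModel I F) p.proj) :
    TPullback I F E :=
  tangentPairEquiv.symm ⟨(⟨p.proj, w⟩, Hor.linearizedVec p w), Hor.linearizedVec_mem p w⟩

/-- The horizontal lift of a vector field `Y` on `E` with respect to the linearized connection:
`(a, b) ↦ (Y(a), B(a, b) Y(a))`. -/
def linearizedHorizontalLift (Y : VectorFieldE I F E) (p : PullbackTotal I F E) : TPullback I F E :=
  Hor.linearizedLift p (Y p.proj)

end EhresmannConnection

theorem tangent_verticalLift_mem (Y : VectorFieldE I F E) (hY : IsProjectable Y)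
    (p : PullbackTotal I F E) :
    tangentMap (totalModel I F) (totalModel I F).tangent (fun a => (⟨a, Y a⟩ : TE I F E))
      (verticalLift I p) ∈ VerT I F E := by
  obtain ⟨X, hX⟩ := hY
  set ξ := verticalLift I p with hξ
  have hYd : MDifferentiableAt (totalModel I F) (totalModel I F).tangent
      (fun a => (⟨a, Y a⟩ : TE I F E)) ξ.proj := Y.contMDiff.mdifferentiable (by simp) _
  have hXd : MDifferentiableAt I I.tangent (fun m => (⟨m, X m⟩ : TangentBundle I M)) ξ.proj.proj :=
    X.contMDiff.mdifferentiable (by simp) _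
  have h1 : HasMFDerivAt (totalModel I F).tangent I.tangent (tangentProj I) (⟨ξ.proj, Y ξ.proj⟩ : TE I F E) _ :=
      hasMFDerivAt_tangentMap_proj (⟨ξ.proj, Y ξ.proj⟩ : TE I F E)
  have h2 := h1.comp ξ.proj hYd.hasMFDerivAt
  have h3 := hXd.hasMFDerivAt.comp ξ.proj (hasMFDerivAt_proj (I := I) ξ.proj)
  have h4 : tangentProj I ∘ (fun a => (⟨a, Y a⟩ : TE I F E)) =
      (fun m => (⟨m, X m⟩ : TangentBundle I M)) ∘ TotalSpace.proj :=
    funext fun a => congrArg (fun z : TangentSpace I a.proj => (⟨a.proj, z⟩ : TangentBundle I M)) (hX a)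
  rw [h4] at h2
  have h5 := DFunLike.congr_fun (hasMFDerivAt_unique h2 h3) ξ.snd
  change mfderiv (totalModel I F).tangent I.tangent (tangentProj I) (⟨ξ.proj, Y ξ.proj⟩ : TE I F E)
    (mfderiv (totalModel I F) (totalModel I F).tangent (fun a => (⟨a, Y a⟩ : TE I F E)) ξ.proj ξ.snd) = 0
  rw [h1.mfderiv]
  refine h5.trans ?_
  have h6 : (ContinuousLinearMap.fst ℝ EB F) ξ.snd = 0 := (mem_Ver ξ).1 (verticalLift_mem p)
  exact (congrArg (mfderiv I I.tangent (fun m => (⟨m, X m⟩ : TangentBundle I M)) ξ.proj.proj) h6).trans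
    (map_zero _)

/-- The fibre derivative `𝓕Y : π^*E → T(π^*E)` of a projectable vector field `Y : E → TE`, regarded
as a bundle map from `π : E → M` to `Tπ : TE → TM`: the map determined by
`ξ_{Tπ}^V ∘ 𝓕Y = TY ∘ ξ_π^V`. -/
def fibreDerivative (Y : VectorFieldE I F E) (hY : IsProjectable Y) (p : PullbackTotal I F E) :
    TPullback I F E :=
  verticalLiftTEquiv.symm ⟨_, tangent_verticalLift_mem Y hY p⟩

end pullback

end LinearizedConnection

end

/-! Fix (a, b) and put v = Tπ(Y(a)). Along the line a + sb the foot in M does not move.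
Projectability therefore gives Tπ(Y(a + sb)) = v for all s, and the basic condition gives Y(a + sb)
= ξ^H(a + sb, v) + (vertical lift of the fixed vector η(π(a))). Preferred charts at points of one
fibre coincide, so the vertical term has constant coordinates. It drops out of d/ds: the curves Y(a
+ sb) and ξ^H(a + sb, v) have the same second-order component T at s = 0, though they start at
different vectors Y(a) and ξ^H(a, v).

Now TY(ξ^V_π(a, b)) is T placed over Y(a). It is also ξ^V_{Tπ}(u) for u = 𝓕Y(a, b), which shows that
u lies over (a, b), that T pr₁ u = Y(a), and that T determines the last coordinate of u. The
velocity defining B(a, b)Y(a) is T placed over ξ^H(a, v), hence the vertical lift of the vector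
obtained from u by replacing Y(a) with ξ^H(a, v). The map T pr₂ sees only the M-component of that
entry, which is v for both, so B(a, b)Y(a) = T pr₂ u. Thus u corresponds to the pair (Y(a), B(a,
b)Y(a)).

The analytic content is `HasMFDerivAt.sub_const_along_fibre`; the algebraic splitting is
`eq_lift_add_of_connector_eq`. -/

namespace LinearizedConnection

section HorBasic

variable {EB : Type*} [NormedAddCommGroup EB] [NormedSpace ℝ EB]
  {HB : Type*} [TopologicalSpace HB] {I : ModelWithCorners ℝ EB HB}
  {M : Type*} [TopologicalSpace M] [ChartedSpace HB M] [IsManifold I ∞ M]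
  {F : Type*} [NormedAddCommGroup F] [NormedSpace ℝ F]
  {E : M → Type*} [TopologicalSpace (TotalSpace F E)] [∀ m, TopologicalSpace (E m)]
  [∀ m, AddCommGroup (E m)] [∀ m, Module ℝ (E m)]
  [FiberBundle F E] [VectorBundle ℝ F E] [ContMDiffVectorBundle ∞ F E I]

/-! ### Derivatives of curves in TE over a line in one fibre -/

/-- Along the line `s ↦ a + s b`, all points of which have the same preferred chart, adding a
vector with constant coordinates does not change the derivative of a curve of tangent vectors. -/
theorem HasMFDerivAt.sub_const_along_fibre {p : PullbackTotal I F E} {f g : ℝ → EB × F} {k : EB × F}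
    (hfg : ∀ s, f s = g s + k) {L : ℝ →L[ℝ] (EB × F) × (EB × F)}
    (hf : HasMFDerivAt 𝓘(ℝ, ℝ) (totalModel I F).tangent
      (fun s : ℝ => (⟨linComb I 1 s p, f s⟩ : TE I F E)) 0 L) :
    HasMFDerivAt 𝓘(ℝ, ℝ) (totalModel I F).tangent
      (fun s : ℝ => (⟨linComb I 1 s p, g s⟩ : TE I F E)) 0 L := by
  have hcoord : ∀ (s : ℝ) (w : EB × F), tangentCoordChange (totalModel I F) (linComb I 1 s p)
      (linComb I 1 0 p) (linComb I 1 s p) w = w := fun s w =>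
    tangentCoordChange_fibre (linComb I 1 0 p) (linComb I 1 s p) rfl w
  refine ⟨?_, ?_⟩
  · have hc := hf.1
    rw [FiberBundle.continuousAt_totalSpace] at hc ⊢
    refine ⟨hc.1, ?_⟩
    have h2 : ContinuousAt (fun s => tangentCoordChange (totalModel I F) (linComb I 1 s p)
      (linComb I 1 0 p) (linComb I 1 s p) (f s)) 0 := hc.2
    change ContinuousAt (fun s => tangentCoordChange (totalModel I F) (linComb I 1 s p)
      (linComb I 1 0 p) (linComb I 1 s p) (g s)) 0
    simp only [hcoord] at h2 ⊢
    have e : g = fun s => f s - k := funext fun s => by rw [hfg, add_sub_cancel_right]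
    rw [e]
    exact h2.sub continuousAt_const
  -- The charts of TE at `f 0` and `g 0` are the same, since they depend only on the common foot. In
  -- this chart the curves differ by the constant `(0, k)`.
  · have e : writtenInExtChartAt 𝓘(ℝ, ℝ) (totalModel I F).tangent 0
          (fun s : ℝ => (⟨linComb I 1 s p, g s⟩ : TE I F E)) =
        fun s => writtenInExtChartAt 𝓘(ℝ, ℝ) (totalModel I F).tangent 0
          (fun s : ℝ => (⟨linComb I 1 s p, f s⟩ : TE I F E)) s - (0, k) := by
      funext s
      change extChartAt (totalModel I F).tangent (⟨linComb I 1 0 p, g 0⟩ : TE I F E)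
          (⟨linComb I 1 s p, g s⟩ : TE I F E) =
        extChartAt (totalModel I F).tangent (⟨linComb I 1 0 p, f 0⟩ : TE I F E)
          (⟨linComb I 1 s p, f s⟩ : TE I F E) - (0, k)
      rw [extChartAt_tangent, extChartAt_tangent]
      refine Prod.ext (sub_zero _).symm ?_
      refine (hcoord s (g s)).trans ?_
      refine Eq.trans ?_ (congrArg (· - k) (hcoord s (f s)).symm)
      rw [hfg, add_sub_cancel_right]
    rw [e]
    exact hf.2.sub_const _

/-! ### Vertical projections and the defining relation of 𝓕Y -/

theorem verticalProj_verticalLift {p : PullbackTotal I F E} {w : Ver I F E}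
    (h : verticalLift I p = w.1) : verticalProj w = fibreSnd I p := by
  have : verticalLiftEquiv p = w := Subtype.ext h
  rw [verticalProj, ← this, Equiv.symm_apply_apply]

/-- The inverse of the vertical lifting never has to be computed: exhibiting a preimage of `V` is
enough. -/
theorem verticalProjT_verticalLiftT {u : TPullback I F E} {V : VerT I F E}
    (h : verticalLiftT I u = V.1) :
    verticalProjT V = tangentMap (pullbackModel I F) (totalModel I F) (fibreSnd I) u := by
  have : verticalLiftTEquiv u = V := Subtype.ext h
  rw [verticalProjT, ← this, Equiv.symm_apply_apply]

/-- The relation ξ^V_{Tπ} ∘ 𝓕Y = TY ∘ ξ^V_π is the only property of the fibre derivative that the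
main argument uses. -/
theorem verticalLiftT_fibreDerivative (Y : VectorFieldE I F E) (hY : IsProjectable Y)
    (p : PullbackTotal I F E) :
    verticalLiftT I (fibreDerivative Y hY p) =
      tangentMap (totalModel I F) (totalModel I F).tangent (fun a => (⟨a, Y a⟩ : TE I F E))
        (verticalLift I p) :=
  congrArg Subtype.val (verticalLiftTEquiv.apply_symm_apply
    (⟨_, tangent_verticalLift_mem Y hY p⟩ : VerT I F E))

/-! ### Splitting a vector by the connector, and the lift along a fibre line -/

namespace EhresmannConnection

variable (Hor : EhresmannConnection I F E)

/-- A tangent vector with vertical projection `b` is the horizontal lift of its projection plus the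
vertical lift of `b`. -/
theorem eq_lift_add_of_connector_eq {a : TotalSpace F E} {w : TangentSpace (totalModel I F) a}
    {b : E a.proj} (h : Hor.connector ⟨a, w⟩ = ⟨a.proj, b⟩) :
    w = Hor.lift a (mfderiv (totalModel I F) I TotalSpace.proj a w) +
      (show TangentSpace (totalModel I F) a from
        ((0, fibreCoord (I := I) (⟨a, b⟩ : PullbackTotal I F E)) : EB × F)) := by
  -- The vertical part of `w` is the vertical lift of a unique pair. Its foot forces `a' = a`, after
  -- which the value of the connector forces `b' = b`.
  obtain ⟨⟨a', b'⟩, hq⟩ := verticalLiftEquiv.surjective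
    (⟨Hor.verticalPart ⟨a, w⟩, Hor.verticalPart_mem ⟨a, w⟩⟩ : Ver I F E)
  have hq' : verticalLift I (⟨a', b'⟩ : PullbackTotal I F E) = Hor.verticalPart ⟨a, w⟩ :=
    congrArg Subtype.val hq
  have hs := (verticalProj_verticalLift (w := ⟨_, Hor.verticalPart_mem ⟨a, w⟩⟩) hq').symm.trans h
  rw [verticalLift_eq] at hq'
  obtain rfl : a' = a := congrArg (fun w : TE I F E => w.proj) hq'
  obtain rfl : b' = b := (TotalSpace.mk_inj (F := F) (E := E) (b := a'.proj)).1 hs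
  have h2 : (show TangentSpace (totalModel I F) a' from
      ((0, fibreCoord (I := I) (⟨a', b'⟩ : PullbackTotal I F E)) : EB × F)) =
    w - Hor.lift a' (mfderiv (totalModel I F) I TotalSpace.proj a' w) := TE_snd hq'
  rw [h2, add_sub_cancel]

/-- Passes from a + sb to 1·a + sb, the form for which the derivatives are computed. Both have the
foot of `p` definitionally, so `v` needs no transport and only the fibre component is rewritten. -/
theorem liftCurve_eq (p : PullbackTotal I F E) (v : TangentSpace I p.proj.proj) :
    Hor.liftCurve p v = fun s => ⟨linComb I 1 s p, Hor.lift (linComb I 1 s p) v⟩ := by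
  funext s
  exact congrArg (fun c : E p.proj.proj =>
      (⟨⟨p.proj.proj, c⟩, Hor.lift ⟨p.proj.proj, c⟩ v⟩ : TE I F E))
    (congrArg (· + s • p.vec) (one_smul ℝ p.proj.snd).symm)

/-! ### Equality of the horizontal lift and the fibre derivative -/

theorem IsHorBasic.linearizedHorizontalLift_eq {Hor : EhresmannConnection I F E}
    {Y : VectorFieldE I F E} (hY : Hor.IsHorBasic Y) (p : PullbackTotal I F E) :
    Hor.linearizedHorizontalLift Y p = fibreDerivative Y hY.1 p := by
  obtain ⟨X, hX⟩ := hY.1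
  obtain ⟨η, hη⟩ := hY.2
  -- This equals X(π(a)), but is written as Tπ(Y(a)) to match the vector occurring in
  -- `linearizedVec`.
  let v : TangentSpace I p.proj.proj :=
    mfderiv (totalModel I F) I TotalSpace.proj p.proj (Y p.proj)
  -- Coordinates of the vertical lift of η(π(a)). The trivialization depends only on the foot in M,
  -- so the same `k` serves at every a + sb.
  let k : EB × F :=
    (0, fibreCoord (I := I) (⟨p.proj, η p.proj.proj⟩ : PullbackTotal I F E))
  let g : ℝ → EB × F := fun s => Hor.lift (linComb I 1 s p) v
  have hdecomp : ∀ s : ℝ, Y (linComb I 1 s p) = g s + k := by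
    intro s
    have h := Hor.eq_lift_add_of_connector_eq (hη (linComb I 1 s p))
    -- X is evaluated at the same foot for every s.
    have e : mfderiv (totalModel I F) I TotalSpace.proj (linComb I 1 s p) (Y (linComb I 1 s p)) =
        v := (hX (linComb I 1 s p)).trans (hX p.proj).symm
    rw [e] at h
    exact h
  have hYd : MDifferentiableAt (totalModel I F) (totalModel I F).tangent
      (fun a => (⟨a, Y a⟩ : TE I F E)) (linComb I 1 0 p) :=
    Y.contMDiff.mdifferentiable (by simp) _
  have hYc := hYd.hasMFDerivAt.comp (0 : ℝ) (hasMFDerivAt_curve p)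
  have hl := HasMFDerivAt.sub_const_along_fibre (p := p) (f := fun s => Y (linComb I 1 s p))
    (g := g) hdecomp hYc
  -- the second-order component shared by `Y` and the horizontal lift of its projection
  let T : TotalSpace F E → (EB × F) × (EB × F) := fun a =>
    mfderiv (totalModel I F) (totalModel I F).tangent (fun a => (⟨a, Y a⟩ : TE I F E)) a
      ((0, fibreCoord p) : EB × F)
  -- The curve starts at 1·a + 0·b, which is only propositionally equal to a.
  have hT : T (linComb I 1 0 p) = T p.proj := congrArg T (linComb_one_zero p)
  -- The horizontal curve inherits the derivative of s ↦ Y(a + sb), which the chain rule gives as TY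
  -- applied to the velocity of the line.
  have hlift : velocity (totalModel I F).tangent (Hor.liftCurve p v) =
      ⟨⟨p.proj, Hor.lift p.proj v⟩, T p.proj⟩ := by
    have h0 : Hor.liftCurve p v 0 = ⟨p.proj, Hor.lift p.proj v⟩ :=
      congrArg (fun c : E p.proj.proj =>
        (⟨⟨p.proj.proj, c⟩, Hor.lift ⟨p.proj.proj, c⟩ v⟩ : TE I F E)) (by simp)
    have h1 : HasMFDerivAt 𝓘(ℝ, ℝ) (totalModel I F).tangent (Hor.liftCurve p v) 0
        (ContinuousLinearMap.toSpanSingleton ℝ (T p.proj)) := by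
      rw [liftCurve_eq, ← hT]
      refine hl.congr_mfderiv (ContinuousLinearMap.ext_ring ?_)
      have h1 : ContinuousLinearMap.toSpanSingleton ℝ (T (linComb I 1 0 p)) 1 =
        T (linComb I 1 0 p) := ContinuousLinearMap.toSpanSingleton_apply_one (R₁ := ℝ) _
      have h2 : ContinuousLinearMap.toSpanSingleton ℝ ((0, fibreCoord p) : EB × F) 1 =
        (0, fibreCoord p) := ContinuousLinearMap.toSpanSingleton_apply_one (R₁ := ℝ) _
      refine Eq.trans ?_ h1.symm
      exact congrArg (mfderiv (totalModel I F) (totalModel I F).tangent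
        (fun a => (⟨a, Y a⟩ : TE I F E)) (linComb I 1 0 p)) h2
    rw [velocity_eq h1]
    exact TTE_congr h0 _
  have hTY : verticalLiftT I (fibreDerivative Y hY.1 p) = ⟨⟨p.proj, Y p.proj⟩, T p.proj⟩ := by
    rw [verticalLiftT_fibreDerivative, verticalLift_eq]
    rfl
  -- Y is a section of TE → E, so TY followed by the tangent map of that projection is the identity.
  have hTp : (T p.proj).1 = (0, fibreCoord p) := by
    have h1 : HasMFDerivAt (totalModel I F).tangent (totalModel I F)
        (TotalSpace.proj : TE I F E → TotalSpace F E) ⟨p.proj, Y p.proj⟩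
        (ContinuousLinearMap.fst ℝ (EB × F) (EB × F)) :=
      hasMFDerivAt_proj (I := totalModel I F) (E := TangentSpace (totalModel I F)) _
    have hYp : MDifferentiableAt (totalModel I F) (totalModel I F).tangent
        (fun a => (⟨a, Y a⟩ : TE I F E)) p.proj := Y.contMDiff.mdifferentiable (by simp) _
    have h2 := h1.comp p.proj hYp.hasMFDerivAt
    exact DFunLike.congr_fun (hasMFDerivAt_unique h2 (hasMFDerivAt_id p.proj))
      ((0, fibreCoord p) : EB × F)
  -- From here on 𝓕Y(a, b) is an arbitrary `u` satisfying `hTY`, so its base point can be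
  -- destructured and identified with `p`.
  generalize fibreDerivative Y hY.1 p = u at hTY ⊢
  rw [verticalLiftT_eq] at hTY
  have hbase : (⟨u.1.proj, u.2.1⟩ : TE I F E) = ⟨p.proj, Y p.proj⟩ :=
    congrArg (fun V : TTE I F E => V.proj) hTY
  have hsnd : (((0, fibreCoord u.1), (0, u.2.2)) : (EB × F) × (EB × F)) = T p.proj := TTE_snd hTY
  obtain ⟨q, c⟩ := u
  obtain rfl : q = p := pullback_ext (congrArg (fun w : TE I F E => w.proj) hbase)
    (congrArg (fun z : EB × F => z.2) ((congrArg Prod.fst hsnd).trans hTp))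
  have hc : c.1 = Y q.proj := TE_snd hbase
  have hfst : ∀ w : TangentSpace (totalModel I F) q.proj,
      mfderiv (totalModel I F) I TotalSpace.proj q.proj w = (w : EB × F).1 := fun w =>
    DFunLike.congr_fun (hasMFDerivAt_proj (I := I) q.proj).mfderiv w
  -- ξ^H(a, v) and Y(a) both project to v; they may differ in their vertical coordinates.
  have hv1 : (Hor.lift q.proj v : EB × F).1 = c.1.1 :=
    ((hfst _).symm.trans (Hor.mfderiv_proj_lift q.proj v)).trans
      ((hfst (Y q.proj)).trans (congrArg Prod.fst hc).symm)
  have hB : Hor.linearizedVec q (Y q.proj) =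
      tangentMap (pullbackModel I F) (totalModel I F) (fibreSnd I) ⟨q, c⟩ := by
    -- The preimage of the velocity is `u` with its entry Y(a) replaced by ξ^H(a, v), a change that
    -- T pr₂ does not detect.
    rw [linearizedVec, verticalProjT_verticalLiftT
      (u := ⟨q, ((Hor.lift q.proj v, c.2) : (EB × F) × F)⟩), tangentMap_fibreSnd,
      tangentMap_fibreSnd]
    · exact TE_ext rfl (Prod.ext hv1 rfl)
    · rw [verticalLiftT_eq]
      refine Eq.trans (b := (⟨⟨q.proj, Hor.lift q.proj v⟩, T q.proj⟩ : TTE I F E)) ?_ hlift.symm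
      exact TTE_ext rfl hsnd
  -- A vector tangent to π^*E is determined by its images under T pr₁ and T pr₂.
  refine (Equiv.symm_apply_eq _).2 (Subtype.ext (Prod.ext ?_ hB))
  exact hbase.symm.trans (tangentMap_fst ⟨q, c⟩).symm

end EhresmannConnection

end HorBasic

end LinearizedConnection

theorem theorem6p4
    {EB : Type*} [NormedAddCommGroup EB] [NormedSpace ℝ EB] [CompleteSpace EB]
    {HB : Type*} [TopologicalSpace HB] (I : ModelWithCorners ℝ EB HB)
    {M : Type*} [TopologicalSpace M] [ChartedSpace HB M] [IsManifold I ∞ M]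
    [BoundarylessManifold I M]
    (F : Type*) [NormedAddCommGroup F] [NormedSpace ℝ F] [CompleteSpace F]
    (E : M → Type*) [TopologicalSpace (TotalSpace F E)] [∀ m, TopologicalSpace (E m)]
    [∀ m, AddCommGroup (E m)] [∀ m, Module ℝ (E m)]
    [FiberBundle F E] [VectorBundle ℝ F E] [ContMDiffVectorBundle ∞ F E I]
    (Hor : LinearizedConnection.EhresmannConnection I F E) (Y : LinearizedConnection.VectorFieldE I F E)
    (hY : Hor.IsHorBasic Y) :
    Hor.linearizedHorizontalLift Y = LinearizedConnection.fibreDerivative Y hY.1 :=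
  funext hY.linearizedHorizontalLift_eq
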